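/- Let $\Gamma$ be a finite Abelian group (written additively) and let $\Sigma\subseteq\Gamma\setminus\{0\}$ be a generating set consisting of exactly $r_\alpha$ involutions, $r_\omega$ pairs $\{s,-s\}$ with $s\neq -s$, and $z_\omega$ further elements whose inverses are not in $\Sigma$. The mixed Abelian Cayley graph $\mathrm{Cay}(\Gamma,\Sigma)$ has vertex set $\Gamma$, and each vertex $u$ is joined to $u+s$ for every $s\in\Sigma$, by an undirected edge if $-s\in\Sigma$ and by an arc from $u$ to $u+s$ if $-s\notin\Sigma$. Its diameter is the maximum, over all ordered pairs of vertices $(u,v)$, of the length of a shortest path from $u$ to $v$, where edges may be used in both directions and arcs only in their own direction. Write $\mathrm{Circ}(N;\Sigma)$ for $\mathrm{Cay}(\mathbb{Z}_N,\Sigma)$. For $k\ge 2$, the maximum order $N$ (number of vertices) of a mixed Abelian Cayley graph with $r_\alpha=r_\omega=z_\omega=1$ and diameter $k$ is as follows, and in each case the graph indicated is such a graph, has diameter $k$, and attains this order. - ($a_0$) For $k=2$: $N=10$, attained by $\mathrm{Circ}(10;\{\pm1,2,5\})$. - ($a$) For $k=3x-1$ with $x\ge 2$: $N=12x^2$, attained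 by $\mathrm{Cay}(\mathbb{Z}_{6x}\times\mathbb{Z}_{2x},\{(\pm1,0),(0,1),(3x,x)\})$. - ($b$) For $k=3x$ with $x\ge 1$: $N=12x^2+8x$, attained by $\mathrm{Circ}(N;\{\pm1,\,12x^2+2x-1,\,6x^2+4x\})$. - ($c$) For $k=3x+1$ with $x\ge 1$: $N=12x^2+16x+4$, attained by $\mathrm{Circ}(N;\{\pm1,\,6x+5,\,6x^2+8x+2\})$. -/

import Mathlib

/-- A mixed graph on the vertex set `V`: undirected edges together with (directed) arcs, no loops. -/
structure MixedGraph (V : Type*) where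
  /-- `Edge u v`: there is an undirected edge between `u` and `v`. -/
  Edge : V → V → Prop
  /-- `Arc u v`: there is an arc from `u` to `v`. -/
  Arc : V → V → Prop
  edge_symm : ∀ u v, Edge u v → Edge v u
  edge_irrefl : ∀ v, ¬ Edge v v
  arc_irrefl : ∀ v, ¬ Arc v v

namespace MixedGraph

/-- `G.HasWalk n u v`: there is a walk of length `n` from `u` to `v`, in which edges may be
traversed in both directions and arcs only in their own direction. -/
inductive HasWalk {V : Type*} (G : MixedGraph V) : ℕ → V → V → Prop
  | nil (v : V) : HasWalk G 0 v v
  | step {n : ℕ} {u v w : V} (h : HasWalk G n u v) (hvw : G.Edge v w ∨ G.Arc v w) :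
      HasWalk G (n + 1) u w

/-- The distance from `u` to `v`: the least length of a walk from `u` to `v`
(`⊤` if there is none). -/
noncomputable def dist {V : Type*} (G : MixedGraph V) (u v : V) : ℕ∞ :=
  ⨅ (n : ℕ) (_ : G.HasWalk n u v), (n : ℕ∞)

/-- The diameter: the supremum of all distances (`⊤` if some vertex is not reachable from
another one, or if the distances are unbounded). -/
noncomputable def diam {V : Type*} (G : MixedGraph V) : ℕ∞ :=
  ⨆ (u : V) (v : V), G.dist u v

end MixedGraph

/-- The mixed Cayley graph `Cay(Γ, S)` of an Abelian group: `u` is joined to `u + s` for every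
`s ∈ S`, by an edge if also `-s ∈ S`, and by an arc if `-s ∉ S`. -/
def mixedCayley {Γ : Type*} [AddCommGroup Γ] (S : Set Γ) : MixedGraph Γ where
  Edge u v := u ≠ v ∧ v - u ∈ S ∧ u - v ∈ S
  Arc u v := v - u ∈ S ∧ u - v ∉ S
  edge_symm _ _ h := ⟨h.1.symm, h.2.2, h.2.1⟩
  edge_irrefl _ h := h.1 rfl
  arc_irrefl _ h := h.2 h.1

/-- `S` is a finite generating set of the Abelian group `Γ`, without the zero element, that consists
of exactly `rα` involutions, `rω` pairs `{s, -s}` of an element that is not an involution and its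
inverse, and `zω` further elements whose inverses do not belong to `S`. -/
structure IsMixedGeneratingSet {Γ : Type*} [AddCommGroup Γ] (S : Set Γ) (rα rω zω : ℕ) :
    Prop where
  finite : S.Finite
  generates : AddSubgroup.closure S = ⊤
  zero_notMem : (0 : Γ) ∉ S
  involutions : {s ∈ S | addOrderOf s = 2}.ncard = rα
  pairs : {s ∈ S | addOrderOf s ≠ 2 ∧ -s ∈ S}.ncard = 2 * rω
  arcs : {s ∈ S | -s ∉ S}.ncard = zω

/-- `Cay(Γ, S)` is a mixed Abelian Cayley graph with parameters `rα`, `rω`, `zω`, diameter `k`, and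
order (number of vertices) `N`. -/
structure IsMixedAbelianCayley {Γ : Type*} [AddCommGroup Γ] (S : Set Γ) (rα rω zω k N : ℕ) :
    Prop where
  finite : Finite Γ
  generating : IsMixedGeneratingSet S rα rω zω
  diam_eq : (mixedCayley S).diam = k
  card_eq : Nat.card Γ = N

/-- The set of the orders of all mixed Abelian Cayley graphs with parameters `rα`, `rω`, `zω` and
diameter `k` (every finite group has an isomorphic copy in `Type`). -/
def mixedAbelianCayleyOrders (rα rω zω k : ℕ) : Set ℕ :=
  {N | ∃ (Γ : Type) (_ : AddCommGroup Γ) (S : Set Γ), IsMixedAbelianCayley S rα rω zω k N}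

/-! Every vertex must be `i • a + j • b + e • ι` with `|i| + j + e ≤ k`, `j ≥ 0` and `e ≤ 1`. The
pairs `(i, j)` with `i • a + j • b ∈ {0, ι}` form a lattice of index `|Γ| / 2`. Rotating it by `(i,
j) ↦ (i + j, j - i)` doubles the index, so `relLattice` has index exactly `|Γ|`, and the region `|i|
+ j ≤ k` becomes, after a reflection, the even points of the triangle `p, q ≥ 0`, `p + q ≤ 2 * k`.

An even class corresponds to a pair `c`, `c + ι`. Either one of these two elements uses `ι`, which
leaves a point off the legs of the triangle, or neither does, which leaves two different points. By
`forall_exists_rep_or_index_le` this forces the odd classes into the triangle as well, unless `3 *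
|Γ| ≤ (2 * k + 1) ^ 2` already. The quotient of `ℤ × ℤ` is then a double-loop digraph of diameter at
most `2 * k`. Its L-shaped fundamental domain (`exists_lShape`, `lShape_area_le`) yields `3 * |Γ| ≤
(2 * k + 2) ^ 2`.

Since `ι` makes `|Γ|` even, this bound is the claimed order for every `k` except 2, where it leaves
12; equality in the area estimate fixes the L-shape, and the group it determines is ruled out by
hand (`CoveredWithin.card_ne_twelve`). The listed graphs are checked by explicit representations.
Their diameter is not below `k` because the same bound for `k - 1` would be violated. -/

namespace MixedGraph

theorem diam_le_iff {V : Type*} (G : MixedGraph V) (k : ℕ) :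
    G.diam ≤ k ↔ ∀ u v, ∃ n ≤ k, G.HasWalk n u v := by
  unfold diam dist
  simp only [iSup_le_iff]
  refine forall_congr' fun u => forall_congr' fun v => ⟨fun h => ?_, ?_⟩
  · by_contra! hn
    have : ((k + 1 : ℕ) : ℕ∞) ≤ ⨅ (n : ℕ) (_ : G.HasWalk n u v), (n : ℕ∞) := by
      refine le_iInf₂ fun n hw => ?_
      have : k < n := by
        by_contra! hk
        exact hn n hk hw
      exact_mod_cast this
    have h2 := this.trans h
    norm_cast at h2
    omega
  · rintro ⟨n, hn, hw⟩
    exact (iInf₂_le n hw).trans (by exact_mod_cast hn)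

end MixedGraph

/-! ### Walks as bounded sums of generators; the shape of the generating set -/

section Walks

variable {Γ : Type*} [AddCommGroup Γ]

theorem mixedCayley_adj_iff {S : Set Γ} (h0 : (0 : Γ) ∉ S) (v w : Γ) :
    (mixedCayley S).Edge v w ∨ (mixedCayley S).Arc v w ↔ w - v ∈ S := by
  constructor
  · rintro (h | h)
    · exact h.2.1
    · exact h.1
  · intro h
    by_cases h' : v - w ∈ S
    · refine Or.inl ⟨?_, h, h'⟩
      rintro rfl
      exact h0 (by simpa using h)
    · exact Or.inr ⟨h, h'⟩

/-- Every element of the group is a sum of at most `k` terms from `a`, `-a`, `b`, and at most one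
copy of `ι`. -/
def CoveredWithin (a b ι : Γ) (k : ℕ) : Prop :=
  ∀ c : Γ, ∃ (i : ℤ) (j e : ℕ), i.natAbs + j + e ≤ k ∧ e ≤ 1 ∧ c = i • a + j • b + e • ι

/-- By commutativity only the number of steps of each kind matters. Opposite steps `a`, `-a` merge
into one integer coefficient and a second `ι` cancels the first, so a representation never costs
more than the walk. -/
theorem exists_rep_of_hasWalk {S : Set Γ} {a b ι : Γ} (hι : ι + ι = 0) (h0 : (0 : Γ) ∉ S)
    (hS : S = {a, -a, b, ι}) {n : ℕ} {u v : Γ} (h : (mixedCayley S).HasWalk n u v) :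
    ∃ (i : ℤ) (j e : ℕ), i.natAbs + j + e ≤ n ∧ e ≤ 1 ∧ v - u = i • a + j • b + e • ι := by
  induction h with
  | nil v => exact ⟨0, 0, 0, by simp⟩
  | @step n u v w h hvw ih =>
    obtain ⟨i, j, e, hle, he, heq⟩ := ih
    rw [mixedCayley_adj_iff h0, hS] at hvw
    have key : w - u = (w - v) + (i • a + j • b + e • ι) := by rw [← heq]; abel
    rw [key]
    rcases hvw with h1 | h1 | h1 | h1
    · exact ⟨i + 1, j, e, by omega, he, by rw [h1]; module⟩
    · exact ⟨i - 1, j, e, by omega, he, by rw [h1]; module⟩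
    · exact ⟨i, j + 1, e, by omega, he, by rw [h1]; module⟩
    · rw [Set.mem_singleton_iff] at h1
      rcases Nat.le_one_iff_eq_zero_or_eq_one.1 he with rfl | rfl
      · exact ⟨i, j, 1, by omega, le_rfl, by rw [h1]; module⟩
      · refine ⟨i, j, 0, by omega, by omega, ?_⟩
        rw [h1]
        have : ι + (i • a + j • b + 1 • ι) = (i • a + j • b) + (ι + ι) := by module
        rw [this, hι]; simp

theorem hasWalk_add_nsmul {S : Set Γ} (h0 : (0 : Γ) ∉ S) {s : Γ} (hs : s ∈ S) {n : ℕ} {u v : Γ}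
    (h : (mixedCayley S).HasWalk n u v) (m : ℕ) :
    (mixedCayley S).HasWalk (n + m) u (v + m • s) := by
  induction m with
  | zero => simpa using h
  | succ m ih =>
    refine .step ih ((mixedCayley_adj_iff h0 _ _).2 ?_)
    rwa [succ_nsmul, ← add_assoc, add_sub_cancel_left]

theorem diam_mixedCayley_le_iff {S : Set Γ} {a b ι : Γ} (hι : ι + ι = 0) (h0 : (0 : Γ) ∉ S)
    (hS : S = {a, -a, b, ι}) (k : ℕ) :
    (mixedCayley S).diam ≤ k ↔ CoveredWithin a b ι k := by
  rw [MixedGraph.diam_le_iff]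
  constructor
  · intro h c
    obtain ⟨n, hn, hw⟩ := h 0 c
    obtain ⟨i, j, e, hle, he, heq⟩ := exists_rep_of_hasWalk hι h0 hS hw
    exact ⟨i, j, e, hle.trans hn, he, by simpa using heq⟩
  · intro h u v
    obtain ⟨i, j, e, hle, he, heq⟩ := h (v - u)
    refine ⟨i.natAbs + j + e, hle, ?_⟩
    have key : ∃ s ∈ S, i.natAbs • s = i • a := by
      rcases Int.natAbs_eq i with hi | hi
      · exact ⟨a, by simp [hS], by conv_rhs => rw [hi, natCast_zsmul]⟩
      · exact ⟨-a, by simp [hS], by conv_rhs => rw [hi, neg_smul, natCast_zsmul, ← smul_neg]⟩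
    obtain ⟨s, hs, hsi⟩ := key
    have hb : b ∈ S := by simp [hS]
    have hi : ι ∈ S := by simp [hS]
    have := hasWalk_add_nsmul h0 hi (hasWalk_add_nsmul h0 hb
      (hasWalk_add_nsmul h0 hs (.nil u) i.natAbs) j) e
    rw [hsi, zero_add] at this
    convert this using 1
    rw [add_assoc, add_assoc, ← add_assoc (i • a), ← heq]
    abel

theorem IsMixedGeneratingSet.exists_eq {S : Set Γ} (h : IsMixedGeneratingSet S 1 1 1) :
    ∃ a b ι : Γ, S = {a, -a, b, ι} ∧ ι + ι = 0 ∧ ι ≠ 0 ∧ b + b ≠ 0 := by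
  obtain ⟨ι, hι⟩ := Set.ncard_eq_one.1 h.involutions
  obtain ⟨b, hb⟩ := Set.ncard_eq_one.1 h.arcs
  obtain ⟨a, c, hac, hp⟩ := Set.ncard_eq_two.1 h.pairs
  simp only [Set.ext_iff, Set.mem_ofPred_eq, Set.mem_insert_iff, Set.mem_singleton_iff] at hι hb hp
  have hιS := (hι ι).2 rfl
  have hbS := (hb b).2 rfl
  have haS := (hp a).2 (Or.inl rfl)
  have hιι : ι + ι = 0 := by
    have := addOrderOf_nsmul_eq_zero ι
    rwa [hιS.2, two_nsmul] at this
  have hc : c = -a := by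
    have h1 := (hp (-a)).1 ⟨haS.2.2, by simpa using haS.2.1, by simpa using haS.1⟩
    rcases h1 with h1 | h1
    · exfalso
      apply haS.2.1
      refine addOrderOf_eq_prime ?_ ?_
      · rw [two_nsmul]; nth_rw 1 [← h1]; simp
      · rintro rfl
        exact h.zero_notMem haS.1
    · exact h1.symm
  refine ⟨a, b, ι, ?_, hιι, ?_, ?_⟩
  · ext s
    simp only [Set.mem_insert_iff, Set.mem_singleton_iff]
    rw [hc] at hp
    constructor
    · intro hs
      by_cases h1 : -s ∈ S
      · by_cases h2 : addOrderOf s = 2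
        · have := (hι s).1 ⟨hs, h2⟩
          tauto
        · have := (hp s).1 ⟨hs, h2, h1⟩
          tauto
      · have := (hb s).1 ⟨hs, h1⟩
        tauto
    · rintro (rfl | rfl | rfl | rfl)
      · exact haS.1
      · exact haS.2.2
      · exact hbS.1
      · exact hιS.1
  · rintro rfl
    exact h.zero_notMem hιS.1
  · intro hbb
    apply hbS.2
    rw [neg_eq_of_add_eq_zero_left hbb]
    exact hbS.1

theorem isMixedGeneratingSet_of_eq {S : Set Γ} {a b ι : Γ} (hS : S = {a, -a, b, ι})
    (hι : ι + ι = 0) (hι0 : ι ≠ 0) (ha : a + a ≠ 0) (hb : b + b ≠ 0) (hba : b + a ≠ 0)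
    (hba' : b ≠ a) (hbι : b + ι ≠ 0) {k : ℕ} (hc : CoveredWithin a b ι k) :
    IsMixedGeneratingSet S 1 1 1 := by
  have hιn : -ι = ι := neg_eq_of_add_eq_zero_left hι
  have hbn : -b ∉ S := by
    rw [hS]
    rintro (h | h | h | h)
    · exact hba (by rw [← h]; simp)
    · exact hba' (neg_injective h)
    · exact hb (by nth_rw 1 [← h]; simp)
    · rw [Set.mem_singleton_iff] at h
      exact hbι (by rw [← h]; simp)
  have horder : ∀ s : Γ, addOrderOf s = 2 → s + s = 0 := by
    intro s hs
    have := addOrderOf_nsmul_eq_zero s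
    rwa [hs, two_nsmul] at this
  have haι : a ≠ ι := by rintro rfl; exact ha hι
  have haι' : -a ≠ ι := by
    intro h
    apply haι
    rw [← hιn, ← h, neg_neg]
  have hbι' : b ≠ ι := by rintro rfl; exact hb hι
  have hna : -a + -a ≠ 0 := by
    intro h
    apply ha
    rw [← neg_add, neg_eq_zero] at h
    exact h
  refine ⟨?_, ?_, ?_, ?_, ?_, ?_⟩
  · rw [hS]; exact Set.toFinite _
  · rw [AddSubgroup.eq_top_iff']
    intro c
    obtain ⟨i, j, e, -, -, rfl⟩ := hc c
    have hm : ∀ s ∈ S, s ∈ AddSubgroup.closure S := fun s hs => AddSubgroup.subset_closure hs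
    exact add_mem (add_mem (zsmul_mem (hm _ (by simp [hS])) _) (nsmul_mem (hm _ (by simp [hS])) _))
      (nsmul_mem (hm _ (by simp [hS])) _)
  · rw [hS]
    rintro (h | h | h | h)
    · exact ha (by rw [← h]; simp)
    · exact hna (by rw [← h]; simp)
    · exact hb (by rw [← h]; simp)
    · exact hι0 h.symm
  · rw [Set.ncard_eq_one]
    refine ⟨ι, Set.ext fun s => ⟨?_, ?_⟩⟩
    · rintro ⟨hs, hs2⟩
      have := horder s hs2
      rw [hS] at hs
      rcases hs with rfl | rfl | rfl | h
      · exact absurd this ha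
      · exact absurd this hna
      · exact absurd this hb
      · exact h
    · rintro rfl
      exact ⟨by simp [hS], addOrderOf_eq_prime (by rw [two_nsmul, hι]) hι0⟩
  · rw [mul_one, Set.ncard_eq_two]
    refine ⟨a, -a, ?_, Set.ext fun s => ⟨?_, ?_⟩⟩
    · intro h
      apply ha
      nth_rw 1 [h]
      simp
    · rintro ⟨hs, hs2, hs3⟩
      rw [hS] at hs
      rcases hs with rfl | rfl | rfl | h
      · simp
      · simp
      · exact absurd hs3 hbn
      · rw [Set.mem_singleton_iff] at h
        subst h
        exact absurd (addOrderOf_eq_prime (by rw [two_nsmul, hι]) hι0) hs2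
    · rintro (rfl | h)
      · exact ⟨by simp [hS], fun h => ha (horder _ h), by simp [hS]⟩
      · rw [Set.mem_singleton_iff] at h
        subst h
        exact ⟨by simp [hS], fun h => hna (horder _ h), by simp [hS]⟩
  · rw [Set.ncard_eq_one]
    refine ⟨b, Set.ext fun s => ⟨?_, ?_⟩⟩
    · rintro ⟨hs, hs2⟩
      rw [hS] at hs
      rcases hs with rfl | rfl | rfl | h
      · exact absurd (by simp [hS]) hs2
      · exact absurd (by simp [hS]) hs2
      · rfl
      · rw [Set.mem_singleton_iff] at h
        subst h
        exact absurd (by simp [hS, hιn]) hs2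
    · rintro rfl
      exact ⟨by simp [hS], hbn⟩

end Walks

/-! ### L-shaped domains of groups with two generators -/

section DoubleLoop

variable {G : Type*} [AddCommGroup G]

/-- `(p, q)` precedes every other pair of coefficients of the same element `p • g + q • h`, ordered
by `p + q` and then by `p`. -/
def IsMinRep (g h : G) (p q : ℕ) : Prop :=
  ∀ p' q' : ℕ, p' • g + q' • h = p • g + q • h → p + q < p' + q' ∨ (p + q = p' + q' ∧ p ≤ p')

namespace IsMinRep

variable {g h : G}

/-- The order is invariant under translation, so a better pair for `(p', q')` would translate to a
better one for `(p, q)`. Minimal pairs thus form a staircase. -/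
theorem mono {p q p' q' : ℕ} (hm : IsMinRep g h p q) (hp : p' ≤ p) (hq : q' ≤ q) :
    IsMinRep g h p' q' := by
  intro r s hrs
  have := hm (r + (p - p')) (s + (q - q')) (by
    have h1 : p • g + q • h = (p' + (p - p')) • g + (q' + (q - q')) • h := by
      rw [Nat.add_sub_cancel' hp, Nat.add_sub_cancel' hq]
    rw [h1, add_smul, add_smul, add_smul, add_smul, add_add_add_comm, hrs, add_add_add_comm])
  omega

theorem unique {p q p' q' : ℕ} (hm : IsMinRep g h p q) (hm' : IsMinRep g h p' q')
    (he : p • g + q • h = p' • g + q' • h) : p = p' ∧ q = q' := by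
  have h1 := hm p' q' he.symm
  have h2 := hm' p q he
  omega

theorem zero (g h : G) : IsMinRep g h 0 0 := by
  intro p' q' _
  omega

theorem exists_rep {d : ℕ} {x : G} (hx : ∃ p q : ℕ, p + q ≤ d ∧ x = p • g + q • h) :
    ∃ p q : ℕ, p + q ≤ d ∧ x = p • g + q • h ∧ IsMinRep g h p q := by
  classical
  have hex : ∃ n p q : ℕ, p + q = n ∧ x = p • g + q • h := by
    obtain ⟨p, q, -, h⟩ := hx
    exact ⟨_, p, q, rfl, h⟩
  have hex2 : ∃ p q : ℕ, p + q = Nat.find hex ∧ x = p • g + q • h := Nat.find_spec hex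
  obtain ⟨q, hq, hxq⟩ := Nat.find_spec hex2
  obtain ⟨p0, q0, hd, hx0⟩ := hx
  refine ⟨Nat.find hex2, q, ?_, hxq, ?_⟩
  · rw [hq]
    exact (Nat.find_min' hex ⟨p0, q0, rfl, hx0⟩).trans hd
  · intro p' q' he
    rw [← hxq] at he
    have h1 : Nat.find hex ≤ p' + q' := Nat.find_min' hex ⟨p', q', rfl, he.symm⟩
    rcases h1.lt_or_eq with h1 | h1
    · left; omega
    · right
      exact ⟨by omega, Nat.find_min' hex2 ⟨q', h1.symm, he.symm⟩⟩

theorem le_of_forall {d p q : ℕ} (hd : ∀ x : G, ∃ p q : ℕ, p + q ≤ d ∧ x = p • g + q • h)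
    (hm : IsMinRep g h p q) : p + q ≤ d := by
  obtain ⟨p', q', hle, he⟩ := hd (p • g + q • h)
  have := hm p' q' he.symm
  omega

theorem add_le_add_of_eq {p q : ℕ} (hm : IsMinRep g h p q) (p' q' : ℕ)
    (he : p' • g + q' • h = p • g + q • h) : p + q ≤ p' + q' := by
  have := hm p' q' he
  omega

end IsMinRep

/-- A group in which every element is a sum of at most `d` terms from `g`, `h` has an L-shaped
fundamental domain. -/
theorem exists_lShape {g h : G} {d : ℕ}
    (hd : ∀ x : G, ∃ p q : ℕ, p + q ≤ d ∧ x = p • g + q • h) :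
    ∃ l m w y : ℕ, w < l ∧ y < m ∧ l • g = y • h ∧ m • h = w • g ∧
      Nat.card G + w * y ≤ l * m ∧ l + m ≤ d + 2 + y ∧ l + m ≤ d + 2 + w := by
  classical
  have hrep : ∀ x : G, ∃ p q : ℕ, p + q ≤ d ∧ x = p • g + q • h ∧ IsMinRep g h p q :=
    fun x => IsMinRep.exists_rep (hd x)
  -- `l` and `m` will be the lengths of the staircase along the two axes; minimal pairs have sum at
  -- most `d`, so `d + 1` lies outside.
  have hl : ∃ l, ¬ IsMinRep g h l 0 := ⟨d + 1, fun hm => by have := hm.le_of_forall hd; omega⟩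
  have hmm : ∃ m, ¬ IsMinRep g h 0 m := ⟨d + 1, fun hm => by have := hm.le_of_forall hd; omega⟩
  obtain ⟨l, hlS, hlmin⟩ : ∃ l, ¬ IsMinRep g h l 0 ∧ ∀ n < l, IsMinRep g h n 0 :=
    ⟨Nat.find hl, Nat.find_spec hl, fun n hn => not_not.1 (Nat.find_min hl hn)⟩
  obtain ⟨m, hmS, hmmin⟩ : ∃ m, ¬ IsMinRep g h 0 m ∧ ∀ n < m, IsMinRep g h 0 n :=
    ⟨Nat.find hmm, Nat.find_spec hmm, fun n hn => not_not.1 (Nat.find_min hmm hn)⟩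
  have hl0 : 0 < l := by
    rcases Nat.eq_zero_or_pos l with rfl | h1
    · exact absurd (IsMinRep.zero g h) hlS
    · exact h1
  have hm0 : 0 < m := by
    rcases Nat.eq_zero_or_pos m with rfl | h1
    · exact absurd (IsMinRep.zero g h) hmS
    · exact h1
  have hltl : ∀ {p q}, IsMinRep g h p q → p < l := by
    intro p q hm
    by_contra! hlp
    exact hlS (hm.mono hlp (Nat.zero_le _))
  have hltm : ∀ {p q}, IsMinRep g h p q → q < m := by
    intro p q hm
    by_contra! hlp
    exact hmS (hm.mono (Nat.zero_le _) hlp)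
  -- a representative of a non-minimal pair never shares a coefficient to decrease with it
  have hfst : ∀ {p q p' q'}, IsMinRep g h p q → IsMinRep g h p' q' → ¬ IsMinRep g h (p + 1) q →
      (p + 1) • g + q • h = p' • g + q' • h → p' = 0 := by
    intro p q p' q' h1 h2 h3 h4
    rcases p' with _ | p'
    · rfl
    · exfalso
      have h5 : p • g + q • h = p' • g + q' • h := by
        have : g + (p • g + q • h) = g + (p' • g + q' • h) := by
          rw [← add_assoc, ← add_assoc, ← succ_nsmul', ← succ_nsmul', h4]
        exact add_left_cancel this
      obtain ⟨rfl, rfl⟩ := h1.unique (h2.mono (Nat.le_succ _) le_rfl) h5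
      exact h3 h2
  have hsnd : ∀ {p q p' q'}, IsMinRep g h p q → IsMinRep g h p' q' → ¬ IsMinRep g h p (q + 1) →
      p • g + (q + 1) • h = p' • g + q' • h → q' = 0 := by
    intro p q p' q' h1 h2 h3 h4
    rcases q' with _ | q'
    · rfl
    · exfalso
      have h5 : p • g + q • h = p' • g + q' • h := by
        rw [succ_nsmul, succ_nsmul, ← add_assoc, ← add_assoc] at h4
        exact add_right_cancel h4
      obtain ⟨rfl, rfl⟩ := h1.unique (h2.mono le_rfl (Nat.le_succ _)) h5
      exact h3 h2
  obtain ⟨w', y, -, hly, hyS⟩ := hrep (l • g)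
  obtain ⟨l', rfl⟩ : ∃ l', l = l' + 1 := ⟨l - 1, by omega⟩
  obtain ⟨m', rfl⟩ : ∃ m', m = m' + 1 := ⟨m - 1, by omega⟩
  have hw' : w' = 0 := hfst (hlmin l' (by omega)) hyS hlS (by simpa using hly)
  subst hw'
  obtain ⟨w, y', -, hmw, hwS⟩ := hrep ((m' + 1) • h)
  have hy' : y' = 0 := hsnd (hmmin m' (by omega)) hwS hmS (by simpa using hmw)
  subst hy'
  simp only [zero_nsmul, zero_add, add_zero] at hly hmw
  have hwl := hltl hwS
  have hym := hltm hyS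
  -- At an inner corner of the staircase the minimal pair of the same element shares neither
  -- coordinate, so the element is zero. If the corner lay outside the `w × y` rectangle, a point on
  -- one axis and a point on the other would both be minimal for one element.
  have hcorner : ∀ {p q}, IsMinRep g h p (q + 1) → IsMinRep g h (p + 1) q →
      ¬ IsMinRep g h (p + 1) (q + 1) → l' + 1 ≤ p + 1 + w ∧ m' + 1 ≤ q + 1 + y := by
    intro p q h1 h2 h3
    obtain ⟨r, s, -, hrs, hS⟩ := hrep ((p + 1) • g + (q + 1) • h)
    have hr := hfst h1 hS h3 hrs
    have hs := hsnd h2 hS h3 hrs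
    subst hr hs
    simp only [zero_nsmul, zero_add] at hrs
    have hp := hltl h2
    have hq := hltm h1
    constructor
    · by_contra! hlt
      have h4 : (p + 1 + w) • g + 0 • h = 0 • g + (m' + 1 - (q + 1)) • h := by
        have h5 : (m' + 1) • h = (m' + 1 - (q + 1)) • h + (q + 1) • h := by
          rw [← add_smul, Nat.sub_add_cancel (by omega)]
        rw [zero_nsmul, zero_nsmul, zero_add, add_zero, add_smul, ← hmw, h5]
        rw [add_comm, add_assoc, add_comm ((q + 1) • h), hrs, add_zero]
      have := (hlmin _ hlt).unique (hmmin (m' + 1 - (q + 1)) (by omega)) h4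
      omega
    · by_contra! hlt
      have h4 : (l' + 1 - (p + 1)) • g + 0 • h = 0 • g + (q + 1 + y) • h := by
        have h5 : (l' + 1) • g = (l' + 1 - (p + 1)) • g + (p + 1) • g := by
          rw [← add_smul, Nat.sub_add_cancel (by omega)]
        rw [zero_nsmul, zero_nsmul, zero_add, add_zero, add_smul, ← hly, h5,
          add_comm ((q + 1) • h), add_assoc, hrs, add_zero]
      have := (hlmin (l' + 1 - (p + 1)) (by omega)).unique (hmmin _ hlt) h4
      omega
  have hmem : ∀ n p q, p + q = n → p < l' + 1 → q < m' + 1 →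
      (p + w < l' + 1 ∨ q + y < m' + 1) → IsMinRep g h p q := by
    intro n
    induction n with
    | zero =>
      intro p q hpq hp hq _
      obtain ⟨rfl, rfl⟩ : p = 0 ∧ q = 0 := by omega
      exact IsMinRep.zero g h
    | succ n ih =>
      intro p q hpq hp hq hor
      rcases p with _ | p
      · exact hmmin q hq
      rcases q with _ | q
      · exact hlmin _ hp
      by_contra hn
      have := hcorner (ih p (q + 1) (by omega) (by omega) hq (by omega))
        (ih (p + 1) q (by omega) hp (by omega) (by omega)) hn
      omega
  -- Inside the removed rectangle, adding both relations gives the pair `(p + w - l, q + y - m)`,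
  -- which represents the same element with a smaller sum.
  have hnot : ∀ p q, l' + 1 ≤ p + w → m' + 1 ≤ q + y → ¬ IsMinRep g h p q := by
    intro p q hp hq hS
    have h1 : (p + w - (l' + 1)) • g + (q + y - (m' + 1)) • h = p • g + q • h := by
      have h2 : (p + w - (l' + 1)) • g + (l' + 1) • g = p • g + w • g := by
        rw [← add_smul, ← add_smul, Nat.sub_add_cancel hp]
      have h3 : (q + y - (m' + 1)) • h + (m' + 1) • h = q • h + y • h := by
        rw [← add_smul, ← add_smul, Nat.sub_add_cancel hq]
      have h4 := congrArg₂ (· + ·) h2 h3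
      simp only [hly, hmw] at h4
      have h5 : (p + w - (l' + 1)) • g + (q + y - (m' + 1)) • h + (y • h + w • g)
          = p • g + q • h + (y • h + w • g) := by
        calc _ = (p + w - (l' + 1)) • g + y • h + ((q + y - (m' + 1)) • h + w • g) := by abel
          _ = _ := h4
          _ = _ := by abel
      exact add_right_cancel h5
    have := hS.add_le_add_of_eq _ _ h1
    omega
  refine ⟨l' + 1, m' + 1, w, y, hwl, hym, hly, hmw, ?_, ?_, ?_⟩
  · let B := Finset.range (l' + 1) ×ˢ Finset.range (m' + 1)
    let R := Finset.Ico (l' + 1 - w) (l' + 1) ×ˢ Finset.Ico (m' + 1 - y) (m' + 1)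
    have hRB : R ⊆ B := by
      intro z hz
      simp only [R, B, Finset.mem_product, Finset.mem_Ico, Finset.mem_range] at hz ⊢
      omega
    have hR : R.card = w * y := by
      simp only [R, Finset.card_product, Nat.card_Ico]
      congr 1 <;> omega
    have hB : B.card = (l' + 1) * (m' + 1) := by simp [B]
    have hcard : Nat.card G ≤ (B \ R).card := by
      have hsurj : Function.Surjective
          (fun z : (B \ R : Finset (ℕ × ℕ)) => z.1.1 • g + z.1.2 • h) := by
        intro x
        obtain ⟨p, q, -, hx, hS⟩ := hrep x
        refine ⟨⟨(p, q), ?_⟩, hx.symm⟩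
        have h1 := hltl hS
        have h2 := hltm hS
        have h3 := hnot p q
        simp only [R, B, Finset.mem_sdiff, Finset.mem_product, Finset.mem_Ico, Finset.mem_range]
        refine ⟨⟨h1, h2⟩, fun h4 => h3 (by omega) (by omega) hS⟩
      have := Nat.card_le_card_of_surjective _ hsurj
      rwa [Nat.card_eq_finsetCard] at this
    rw [Finset.card_sdiff_of_subset hRB, hR, hB] at hcard
    have := Finset.card_le_card hRB
    rw [hR, hB] at this
    omega
  -- The two outer corners of the L are minimal, so their coordinate sums are at most `d`.
  · have := (hmem _ l' (m' - y) rfl (by omega) (by omega) (Or.inr (by omega))).le_of_forall hd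
    omega
  · have := (hmem _ (l' - w) m' rfl (by omega) (by omega) (Or.inl (by omega))).le_of_forall hd
    omega

/-- Put `s = l + m` and `D = d + 2`. If `s ≥ D`, then `w` and `y` are at least `s - D`, so `N ≤ s² /
4 - (s - D)²`, whose maximum, at `s = 4 * D / 3`, is `D² / 3`. If `s ≤ D`, already `N ≤ D² / 4`. -/
theorem lShape_area_le {N d l m w y : ℕ} (hw : w < l) (hy : y < m) (hN : N + w * y ≤ l * m)
    (h1 : l + m ≤ d + 2 + y) (h2 : l + m ≤ d + 2 + w) : 3 * N ≤ (d + 2) ^ 2 := by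
  zify at *
  rcases le_total ((l : ℤ) + m) (d + 2) with h | h
  · nlinarith [sq_nonneg ((l : ℤ) - m), mul_nonneg (Int.natCast_nonneg w) (Int.natCast_nonneg y)]
  · have : ((l : ℤ) + m - (d + 2)) * (l + m - (d + 2)) ≤ w * y :=
      mul_le_mul (by linarith) (by linarith) (by linarith) (by linarith)
    nlinarith [sq_nonneg ((l : ℤ) - m), sq_nonneg (3 * ((l : ℤ) + m) - 4 * (d + 2))]

end DoubleLoop

/-! ### Lattices of even pairs and representatives in a triangle -/

section Lattice

/-- Compare `M` with `Aℤ × Bℤ`, of index `A * B`. As `A` is even and `P` odd, `(P, -Q)` is a further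
element, so the relative index is at least 2. If it is 2, then `A ∣ 2 * P` and `B ∣ 2 * Q`, which
keeps `A` and `B` below two thirds of `K + 1`; if it is at least 3, `A * B ≤ (K + 1) ^ 2` suffices.
-/
theorem three_mul_index_le_of_odd_mem {M : AddSubgroup (ℤ × ℤ)}
    (heven : ∀ z ∈ M, Even (z.1 + z.2)) {K A B P Q : ℕ} (hA : 0 < A) (hB : 0 < B)
    (hAM : ((A : ℤ), (0 : ℤ)) ∈ M) (hBM : ((0 : ℤ), (B : ℤ)) ∈ M)
    (hPQ : ((P : ℤ), -(Q : ℤ)) ∈ M) (hP : Odd P) (hQ : Odd Q)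
    (hAP : A + P ≤ K + 1) (hBQ : B + Q ≤ K + 1) : 3 * M.index ≤ (K + 1) ^ 2 := by
  have hAe : Even (A : ℤ) := by simpa using heven _ hAM
  have hBe : Even (B : ℤ) := by simpa using heven _ hBM
  let M₀ : AddSubgroup (ℤ × ℤ) :=
    (AddSubgroup.zmultiples (A : ℤ)).prod (AddSubgroup.zmultiples (B : ℤ))
  have hmem : ∀ x y : ℤ, (x, y) ∈ M₀ ↔ (A : ℤ) ∣ x ∧ (B : ℤ) ∣ y := by
    intro x y
    simp only [M₀, AddSubgroup.mem_prod, Int.mem_zmultiples_iff]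
  have hindex : M₀.index = A * B := by
    rw [AddSubgroup.index_prod, Int.index_zmultiples, Int.index_zmultiples]; simp
  have hle : M₀ ≤ M := by
    rintro ⟨x, y⟩ hxy
    obtain ⟨⟨r, rfl⟩, ⟨s, rfl⟩⟩ := (hmem _ _).1 hxy
    have := add_mem (zsmul_mem hAM r) (zsmul_mem hBM s)
    simpa [mul_comm] using this
  have hmul := AddSubgroup.relIndex_mul_index hle
  rw [hindex] at hmul
  have hAB : 0 < A * B := Nat.mul_pos hA hB
  have hPQ0 : ((P : ℤ), -(Q : ℤ)) ∉ M₀ := by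
    intro h
    have h1 := ((hmem _ _).1 h).1
    have h2 : Even (P : ℤ) := hAe.trans_dvd h1
    rw [Int.even_coe_nat] at h2
    exact Nat.not_even_iff_odd.2 hP h2
  have hr0 : M₀.relIndex M ≠ 0 := by
    intro h
    rw [h, zero_mul] at hmul
    omega
  have hr1 : M₀.relIndex M ≠ 1 := by
    intro h
    exact hPQ0 (AddSubgroup.relIndex_eq_one.1 h hPQ)
  rcases eq_or_ne (M₀.relIndex M) 2 with h2 | h2
  · have h3 : ((P : ℤ), -(Q : ℤ)) + ((P : ℤ), -(Q : ℤ)) ∈ M₀ := by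
      have := AddSubgroup.add_self_mem_of_index_two (H := M₀.addSubgroupOf M) h2 ⟨_, hPQ⟩
      simpa [AddSubgroup.mem_addSubgroupOf] using this
    have h4 := (hmem _ _).1 h3
    have h5 : A ≤ 2 * P := by
      have : (A : ℤ) ≤ P + P := Int.le_of_dvd (by have := hP.pos; omega) h4.1
      omega
    have h6 : B ≤ 2 * Q := by
      have h7 := h4.2
      rw [← neg_add, dvd_neg] at h7
      have : (B : ℤ) ≤ Q + Q := Int.le_of_dvd (by have := hQ.pos; omega) h7
      omega
    rw [h2] at hmul
    have h7 : 3 * A ≤ 2 * (K + 1) := by omega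
    have h8 : 3 * B ≤ 2 * (K + 1) := by omega
    have h9 := Nat.mul_le_mul h7 h8
    nlinarith
  · have h3 : 3 ≤ M₀.relIndex M := by omega
    have h4 := Nat.mul_le_mul_right M.index h3
    have h5 : A * B ≤ (K + 1) * (K + 1) := Nat.mul_le_mul (by omega) (by omega)
    nlinarith

/-- If the classes of even pairs modulo a lattice of even pairs are represented in a triangle either
away from its legs or twice, then all classes are represented in that triangle, or the lattice has
small index. -/
theorem forall_exists_rep_or_index_le {M : AddSubgroup (ℤ × ℤ)}
    (heven : ∀ z ∈ M, Even (z.1 + z.2)) {K : ℕ}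
    (hE : ∀ p₀ q₀ : ℤ, Even (p₀ + q₀) →
      (∃ p q : ℕ, 1 ≤ p ∧ 1 ≤ q ∧ p + q ≤ K ∧ (p₀ - p, q₀ - q) ∈ M) ∨
      ∃ p q p' q' : ℕ, ¬ (p = p' ∧ q = q') ∧ p + q ≤ K ∧ p' + q' ≤ K ∧
        (p₀ - p, q₀ - q) ∈ M ∧ (p₀ - p', q₀ - q') ∈ M) :
    (∀ p₀ q₀ : ℤ, ∃ p q : ℕ, p + q ≤ K ∧ (p₀ - p, q₀ - q) ∈ M) ∨ 3 * M.index ≤ (K + 1) ^ 2 := by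
  by_contra! hcon
  obtain ⟨⟨p₀, q₀, hno⟩, hbig⟩ := hcon
  have hodd : ¬ Even (p₀ + q₀) := by
    intro h
    rcases hE p₀ q₀ h with ⟨p, q, -, -, h1, h2⟩ | ⟨p, q, p', q', -, h1, -, h2, -⟩
    · exact hno p q h1 h2
    · exact hno p q h1 h2
  rw [Int.not_even_iff_odd] at hodd
  -- a class next to the uncovered one is represented only on one leg, at least twice
  have hx : ∀ p q : ℕ, p + q ≤ K → (p₀ + 1 - p, q₀ - q) ∈ M → p = 0 := by
    intro p q h1 h2
    rcases p with _ | p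
    · rfl
    · refine absurd ?_ (hno p q (by omega))
      convert h2 using 2
      push_cast; ring
  have hy : ∀ p q : ℕ, p + q ≤ K → (p₀ - p, q₀ + 1 - q) ∈ M → q = 0 := by
    intro p q h1 h2
    rcases q with _ | q
    · rfl
    · refine absurd ?_ (hno p q (by omega))
      convert h2 using 2
      push_cast; ring
  have hX : ∃ q B : ℕ, 0 < B ∧ q + B ≤ K ∧ (p₀ + 1, q₀ - q) ∈ M ∧ ((0 : ℤ), (B : ℤ)) ∈ M := by
    rcases hE (p₀ + 1) q₀ (by grind) with ⟨p, q, h0, -, h1, h2⟩ | ⟨p, q, p', q', hne, h1, h1', h2, h2'⟩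
    · have := hx p q h1 h2
      omega
    · obtain rfl := hx p q h1 h2
      obtain rfl := hx p' q' h1' h2'
      simp only [Nat.cast_zero, sub_zero] at h2 h2'
      rcases lt_or_gt_of_ne (show q ≠ q' by tauto) with h | h
      · refine ⟨q, q' - q, by omega, by omega, h2, ?_⟩
        convert sub_mem h2 h2' using 1
        ext <;> simp; omega
      · refine ⟨q', q - q', by omega, by omega, h2', ?_⟩
        convert sub_mem h2' h2 using 1
        ext <;> simp; omega
  have hY : ∃ p A : ℕ, 0 < A ∧ p + A ≤ K ∧ (p₀ - p, q₀ + 1) ∈ M ∧ ((A : ℤ), (0 : ℤ)) ∈ M := by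
    rcases hE p₀ (q₀ + 1) (by grind) with ⟨p, q, -, h0, h1, h2⟩ | ⟨p, q, p', q', hne, h1, h1', h2, h2'⟩
    · have := hy p q h1 h2
      omega
    · obtain rfl := hy p q h1 h2
      obtain rfl := hy p' q' h1' h2'
      simp only [Nat.cast_zero, sub_zero] at h2 h2'
      rcases lt_or_gt_of_ne (show p ≠ p' by tauto) with h | h
      · refine ⟨p, p' - p, by omega, by omega, h2, ?_⟩
        convert sub_mem h2 h2' using 1
        ext <;> simp; omega
      · refine ⟨p', p - p', by omega, by omega, h2', ?_⟩
        convert sub_mem h2' h2 using 1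
        ext <;> simp; omega
  obtain ⟨q, B, hB, hqB, hq, hBM⟩ := hX
  obtain ⟨p, A, hA, hpA, hp, hAM⟩ := hY
  have hPQ : (((p + 1 : ℕ) : ℤ), -((q + 1 : ℕ) : ℤ)) ∈ M := by
    convert sub_mem hq hp using 1
    ext <;> simp <;> ring
  have h1 := heven _ hq
  have h2 := heven _ hp
  have hQ : Odd (q + 1) := by grind
  have hP : Odd (p + 1) := by grind
  have := three_mul_index_le_of_odd_mem (K := K) heven hA hB hAM hBM hPQ hP hQ (by omega) (by omega)
  omega

end Lattice

/-! ### The upper bound on the order, and the exclusion of order 12 for `k = 2` -/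

section UpperBound

variable {Γ : Type*} [AddCommGroup Γ]

/-- The map `(i, j) ↦ i • a + j • b`. -/
def pairHom (a b : Γ) : ℤ × ℤ →+ Γ where
  toFun z := z.1 • a + z.2 • b
  map_zero' := by simp
  map_add' z z' := by simp only [Prod.fst_add, Prod.snd_add]; module

/-- The rotation `(i, j) ↦ (i + j, j - i)` onto the pairs of even sum. -/
def rotHom : ℤ × ℤ →+ ℤ × ℤ where
  toFun z := (z.1 + z.2, z.2 - z.1)
  map_zero' := by simp
  map_add' z z' := by ext <;> simp <;> ring

/-- The rotated lattice of the pairs `(i, j)` for which `i • a + j • b` is a multiple of `ι`. -/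
def relLattice (a b ι : Γ) : AddSubgroup (ℤ × ℤ) :=
  ((AddSubgroup.zmultiples ι).comap (pairHom a b)).map rotHom

theorem mem_zmultiples_iff_of_add_self {ι x : Γ} (hι : ι + ι = 0) :
    x ∈ AddSubgroup.zmultiples ι ↔ x = 0 ∨ x = ι := by
  constructor
  · intro h
    obtain ⟨n, rfl⟩ := AddSubgroup.mem_zmultiples_iff.1 h
    rcases Int.even_or_odd' n with ⟨m, rfl | rfl⟩
    · left
      rw [mul_comm, mul_smul, two_smul, hι, smul_zero]
    · right
      rw [add_smul, mul_comm, mul_smul, two_smul, hι, smul_zero, one_smul, zero_add]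
  · rintro (rfl | rfl)
    · exact zero_mem _
    · exact AddSubgroup.mem_zmultiples _

theorem mem_relLattice {a b ι : Γ} (hι : ι + ι = 0) {x y : ℤ} :
    (x, y) ∈ relLattice a b ι ↔
      ∃ i j : ℤ, i + j = x ∧ j - i = y ∧ (i • a + j • b = 0 ∨ i • a + j • b = ι) := by
  simp only [relLattice, AddSubgroup.mem_map, AddSubgroup.mem_comap,
    mem_zmultiples_iff_of_add_self hι]
  constructor
  · rintro ⟨⟨i, j⟩, h, he⟩
    rw [rotHom] at he
    simp only [AddMonoidHom.coe_mk, ZeroHom.coe_mk, Prod.mk.injEq] at he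
    exact ⟨i, j, he.1, he.2, h⟩
  · rintro ⟨i, j, h1, h2, h⟩
    exact ⟨(i, j), h, by simp [rotHom, h1, h2]⟩

/-- The factor 2 lost by passing to `Γ / ⟨ι⟩` is regained because the rotation has image of index 2.
-/
theorem index_relLattice {a b ι : Γ} (hι : ι + ι = 0) (hι0 : ι ≠ 0) {k : ℕ}
    (hc : CoveredWithin a b ι k) : (relLattice a b ι).index = Nat.card Γ := by
  have hinj : rotHom.ker = ⊥ := by
    rw [AddMonoidHom.ker_eq_bot_iff]
    rintro ⟨i, j⟩ ⟨i', j'⟩ h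
    simp only [rotHom, AddMonoidHom.coe_mk, ZeroHom.coe_mk, Prod.mk.injEq] at h
    ext <;> simp <;> omega
  have hrange : rotHom.range.index = 2 := by
    rw [AddSubgroup.index_eq_two_iff]
    have hm : ∀ z : ℤ × ℤ, z ∈ rotHom.range ↔ Even (z.1 + z.2) := by
      rintro ⟨x, y⟩
      constructor
      · rintro ⟨⟨i, j⟩, h⟩
        simp only [rotHom, AddMonoidHom.coe_mk, ZeroHom.coe_mk, Prod.mk.injEq] at h
        exact ⟨j, by simp only; omega⟩
      · rintro ⟨j, h⟩
        simp only at h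
        refine ⟨(x - j, j), ?_⟩
        simp only [rotHom, AddMonoidHom.coe_mk, ZeroHom.coe_mk, Prod.mk.injEq]
        omega
    refine ⟨(1, 0), fun z => ?_⟩
    simp only [hm, Prod.fst_add, Prod.snd_add, add_zero, xor_iff_iff_not]
    grind
  have hsurj : Function.Surjective
      ((QuotientAddGroup.mk' (AddSubgroup.zmultiples ι)).comp (pairHom a b)) := by
    intro x
    obtain ⟨c, rfl⟩ := QuotientAddGroup.mk_surjective x
    obtain ⟨i, j, e, -, -, h⟩ := hc c
    refine ⟨(i, j), ?_⟩
    simp only [AddMonoidHom.comp_apply, QuotientAddGroup.mk'_apply]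
    rw [QuotientAddGroup.eq]
    simp only [pairHom, AddMonoidHom.coe_mk, ZeroHom.coe_mk]
    rw [h, natCast_zsmul, neg_add_cancel_left]
    exact nsmul_mem (AddSubgroup.mem_zmultiples _) _
  have hK : ((AddSubgroup.zmultiples ι).comap (pairHom a b)).index =
      (AddSubgroup.zmultiples ι).index := by
    have h1 : (AddSubgroup.zmultiples ι).comap (pairHom a b) =
        ((QuotientAddGroup.mk' (AddSubgroup.zmultiples ι)).comp (pairHom a b)).ker := by
      rw [← AddMonoidHom.comap_ker, QuotientAddGroup.ker_mk']
    rw [h1, AddSubgroup.index_ker, AddMonoidHom.range_eq_top.2 hsurj, AddSubgroup.card_top,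
      AddSubgroup.index]
  rw [relLattice, AddSubgroup.index_map, hinj, sup_bot_eq, hrange, hK]
  have h2 : Nat.card (AddSubgroup.zmultiples ι) = 2 := by
    rw [Nat.card_zmultiples]
    exact addOrderOf_eq_prime (by rw [two_nsmul, hι]) hι0
  have h3 := AddSubgroup.card_mul_index (AddSubgroup.zmultiples ι)
  rw [h2] at h3
  omega

theorem exists_rep_or_card_le {a b ι : Γ} (hι : ι + ι = 0) (hι0 : ι ≠ 0) {k : ℕ}
    (hc : CoveredWithin a b ι k) :
    (∀ p₀ q₀ : ℤ, ∃ p q : ℕ, p + q ≤ 2 * k ∧ (p₀ - p, q₀ - q) ∈ relLattice a b ι) ∨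
      3 * Nat.card Γ ≤ (2 * k + 1) ^ 2 := by
  rw [← index_relLattice hι hι0 hc]
  refine forall_exists_rep_or_index_le ?_ ?_
  · rintro ⟨x, y⟩ h
    obtain ⟨i, j, rfl, rfl, -⟩ := (mem_relLattice hι).1 h
    exact ⟨j, by simp only; ring⟩
  · intro p₀ q₀ heven
    -- the element of `Γ` in the class of `(k - p₀, k - q₀)`
    obtain ⟨s, hs⟩ := heven
    obtain ⟨j₀, i₀, hp, hq⟩ : ∃ j₀ i₀ : ℤ, p₀ = k - (i₀ + j₀) ∧ q₀ = k - (j₀ - i₀) :=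
      ⟨k - s, s - p₀, by omega, by omega⟩
    subst hp hq
    have hιn : -ι = ι := neg_eq_of_add_eq_zero_left hι
    -- The triangle point is `p = k - i - j`, `q = k - j + i`, with `p + q = 2 * k - 2 * j`. Both
    -- are nonnegative as `|i| + j ≤ k`, and both are positive when a copy of `ι` takes up one of
    -- the `k` terms.
    have key : ∀ (c : Γ), (c = i₀ • a + j₀ • b ∨ c = i₀ • a + j₀ • b + ι) → ∃ (i : ℤ) (j : ℕ),
        i.natAbs + j ≤ k ∧ ((k - (i₀ + j₀) - ((k - i - j).toNat : ℕ),
          k - (j₀ - i₀) - ((k - j + i).toNat : ℕ)) ∈ relLattice a b ι) ∧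
        (i.natAbs + j + 1 ≤ k ∨ c = i • a + j • b) := by
      intro c hcc
      obtain ⟨i, j, e, hle, he, h⟩ := hc c
      refine ⟨i, j, by omega, (mem_relLattice hι).2 ⟨i - i₀, j - j₀, by omega, by omega, ?_⟩, ?_⟩
      · have h1 : (i - i₀) • a + ((j : ℤ) - j₀) • b = (c - (i₀ • a + j₀ • b)) - e • ι := by
          rw [h]; module
        rw [h1]
        rcases Nat.le_one_iff_eq_zero_or_eq_one.1 he with rfl | rfl <;> rcases hcc with h2 | h2
        · left; rw [h2]; simp
        · right; rw [h2]; simp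
        · right; rw [h2]; simp [hιn]
        · left; rw [h2]; simp
      · rcases Nat.le_one_iff_eq_zero_or_eq_one.1 he with rfl | rfl
        · right; rw [h]; simp
        · left; exact hle
    obtain ⟨i, j, h1, h2, h3⟩ := key _ (Or.inl rfl)
    obtain ⟨i', j', h1', h2', h3'⟩ := key _ (Or.inr rfl)
    rcases h3 with h3 | h3
    · exact Or.inl ⟨_, _, by omega, by omega, by omega, h2⟩
    rcases h3' with h3' | h3'
    · exact Or.inl ⟨_, _, by omega, by omega, by omega, h2'⟩
    refine Or.inr ⟨_, _, _, _, ?_, by omega, by omega, h2, h2'⟩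
    rintro ⟨h4, h5⟩
    have hi : i = i' := by omega
    have hj : j = j' := by omega
    subst hi hj
    rw [h3] at h3'
    exact hι0 (by simpa using h3')

/-- The lattice of relations of a covered group contains the two sides of an L-shaped domain. -/
theorem exists_lShape_relLattice {a b ι : Γ} {K : ℕ}
    (hcov : ∀ p₀ q₀ : ℤ, ∃ p q : ℕ, p + q ≤ K ∧ (p₀ - p, q₀ - q) ∈ relLattice a b ι) :
    ∃ l m w y : ℕ, w < l ∧ y < m ∧ ((l : ℤ), -(y : ℤ)) ∈ relLattice a b ι ∧
      (-(w : ℤ), (m : ℤ)) ∈ relLattice a b ι ∧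
      (relLattice a b ι).index + w * y ≤ l * m ∧ l + m ≤ K + 2 + y ∧ l + m ≤ K + 2 + w := by
  set M := relLattice a b ι
  have hcomb : ∀ p q : ℕ, p • (QuotientAddGroup.mk (1, 0) : (ℤ × ℤ) ⧸ M) +
      q • (QuotientAddGroup.mk (0, 1) : (ℤ × ℤ) ⧸ M) =
        QuotientAddGroup.mk ((p : ℤ), (q : ℤ)) := by
    intro p q
    rw [← QuotientAddGroup.mk_nsmul, ← QuotientAddGroup.mk_nsmul, ← QuotientAddGroup.mk_add]
    simp
  obtain ⟨l, m, w, y, h1, h2, h3, h4, h5⟩ := exists_lShape (d := K)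
    (g := (QuotientAddGroup.mk (1, 0) : (ℤ × ℤ) ⧸ M)) (h := QuotientAddGroup.mk (0, 1)) (by
      intro x
      obtain ⟨⟨p₀, q₀⟩, rfl⟩ := QuotientAddGroup.mk_surjective x
      obtain ⟨p, q, hle, hm⟩ := hcov p₀ q₀
      refine ⟨p, q, hle, ?_⟩
      rw [hcomb, eq_comm, QuotientAddGroup.eq]
      convert hm using 1
      ext <;> simp <;> ring)
  refine ⟨l, m, w, y, h1, h2, ?_, ?_, h5⟩
  · have h6 := hcomb 0 y
    have h7 := hcomb l 0
    rw [zero_smul, zero_add] at h6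
    rw [zero_smul, add_zero, h3, h6, QuotientAddGroup.eq] at h7
    convert h7 using 1
    ext <;> simp
  · have h6 := hcomb 0 m
    have h7 := hcomb w 0
    rw [zero_smul, zero_add] at h6
    rw [zero_smul, add_zero, ← h4, h6, eq_comm, QuotientAddGroup.eq] at h7
    convert h7 using 1
    ext <;> simp

theorem CoveredWithin.three_mul_card_le {a b ι : Γ} (hι : ι + ι = 0) (hι0 : ι ≠ 0) {k : ℕ}
    (hc : CoveredWithin a b ι k) : 3 * Nat.card Γ ≤ (2 * k + 2) ^ 2 := by
  rcases exists_rep_or_card_le hι hι0 hc with h | h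
  · obtain ⟨l, m, w, y, h1, h2, -, -, h3, h4, h5⟩ := exists_lShape_relLattice h
    rw [index_relLattice hι hι0 hc] at h3
    exact lShape_area_le h1 h2 h3 h4 h5
  · exact h.trans (Nat.pow_le_pow_left (by omega) 2)

theorem two_dvd_card [Finite Γ] {ι : Γ} (hι : ι + ι = 0) (hι0 : ι ≠ 0) : 2 ∣ Nat.card Γ := by
  rw [← addOrderOf_eq_prime (p := 2) (by rw [two_nsmul, hι]) hι0]
  exact addOrderOf_dvd_natCard ι

/-- Here `Γ` is cyclic of order 12, generated by `a`, and `8 • a` is not a sum of two or fewer of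
the terms `±a`, `3 • a`, `6 • a`. -/
theorem not_coveredWithin_two_of_eq {a ι : Γ} (hcard : Nat.card Γ = 12) (hι : ι = 6 • a) :
    ¬ CoveredWithin a (3 • a) ι 2 := by
  intro hc
  have hgen : ∀ c : Γ, c ∈ AddSubgroup.zmultiples a := by
    intro c
    obtain ⟨i, j, e, -, -, rfl⟩ := hc c
    rw [hι]
    have ha := AddSubgroup.mem_zmultiples a
    exact add_mem (add_mem (zsmul_mem ha _) (nsmul_mem (nsmul_mem ha _) _))
      (nsmul_mem (nsmul_mem ha _) _)
  have hord : addOrderOf a = 12 := by rw [addOrderOf_eq_card_of_forall_mem_zmultiples hgen, hcard]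
  obtain ⟨i, j, e, hle, he, h⟩ := hc (8 • a)
  have h0 : (i + 3 * j + 6 * e - 8 : ℤ) • a = 0 := by
    have : (i + 3 * j + 6 * e - 8 : ℤ) • a = (i • a + j • (3 • a) + e • ι) - 8 • a := by
      rw [hι]; module
    rw [this, ← h, sub_self]
  have h1 := addOrderOf_dvd_iff_zsmul_eq_zero.2 h0
  rw [hord] at h1
  omega

theorem CoveredWithin.neg {a b ι : Γ} {k : ℕ} (hc : CoveredWithin a b ι k) :
    CoveredWithin (-a) b ι k := by
  intro c
  obtain ⟨i, j, e, hle, he, h⟩ := hc c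
  exact ⟨-i, j, e, by omega, he, by rw [h]; simp⟩

theorem CoveredWithin.card_ne_twelve {a b ι : Γ} (hι : ι + ι = 0) (hι0 : ι ≠ 0) (hb : b + b ≠ 0)
    (hc : CoveredWithin a b ι 2) : Nat.card Γ ≠ 12 := by
  intro hcard
  rcases exists_rep_or_card_le hι hι0 hc with h | h
  swap
  · omega
  obtain ⟨l, m, w, y, h1, h2, hl, hm, h3, h4, h5⟩ := exists_lShape_relLattice h
  rw [index_relLattice hι hι0 hc, hcard] at h3
  -- A crude bound that makes the search finite: order 12 is the equality case of the area estimate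
  -- with `d + 2 = 6`.
  have hlm : l + m ≤ 10 := by
    zify at *
    by_contra! hcon
    nlinarith [sq_nonneg ((l : ℤ) - m), mul_le_mul (show (l : ℤ) + m - 6 ≤ w by linarith)
      (show (l : ℤ) + m - 6 ≤ y by linarith) (by linarith) (by linarith)]
  have hval : l = 4 ∧ m = 4 ∧ w = 2 ∧ y = 2 := by
    have hl' : l ≤ 10 := by omega
    have hm' : m ≤ 10 := by omega
    interval_cases l <;> interval_cases m <;> first | omega | skip
    all_goals
      interval_cases w <;> omega
  obtain ⟨rfl, rfl, rfl, rfl⟩ := hval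
  -- Rotated back, `(2, 2)` reads `2 • b ∈ {0, ι}` and `(4, -2)` reads `3 • a + b ∈ {0, ι}`. As `2 •
  -- b ≠ 0`, this gives `ι = 2 • b` and `b = ±3 • a`.
  have hs := add_mem hl hm
  obtain ⟨i, j, hi, hj, hab⟩ := (mem_relLattice hι).1 hs
  obtain ⟨i', j', hi', hj', hab'⟩ := (mem_relLattice hι).1 hl
  obtain rfl : i = 0 := by omega
  obtain rfl : j = 2 := by omega
  obtain rfl : i' = 3 := by omega
  obtain rfl : j' = 1 := by omega
  rw [zero_smul, zero_add, two_smul] at hab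
  have hbι : b + b = ι := by tauto
  rw [one_smul] at hab'
  rcases hab' with h6 | h6
  · have hb3 : b = 3 • (-a) := by
      rw [eq_neg_of_add_eq_zero_right h6]; module
    refine not_coveredWithin_two_of_eq (a := -a) hcard ?_ (hb3 ▸ hc.neg)
    rw [← hbι, hb3]; module
  · have hb3 : b = 3 • a := by
      rw [← hbι] at h6
      rw [← add_right_cancel h6]; module
    refine not_coveredWithin_two_of_eq (a := a) hcard ?_ (hb3 ▸ hc)
    rw [← hbι, hb3]; module

end UpperBound

theorem card_bounds_of_mem_orders {k N : ℕ} (h : N ∈ mixedAbelianCayleyOrders 1 1 1 k) :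
    2 ∣ N ∧ 3 * N ≤ (2 * k + 2) ^ 2 ∧ (k = 2 → N ≠ 12) := by
  obtain ⟨Γ, _, S, hfin, hgen, hdiam, hcard⟩ := h
  obtain ⟨a, b, ι, hS, hι, hι0, hb⟩ := hgen.exists_eq
  have hc : CoveredWithin a b ι k :=
    (diam_mixedCayley_le_iff hι hgen.zero_notMem hS k).1 hdiam.le
  rw [← hcard]
  refine ⟨two_dvd_card hι hι0, hc.three_mul_card_le hι hι0, ?_⟩
  rintro rfl
  exact hc.card_ne_twelve hι hι0 hb

/-- A criterion for a mixed Abelian Cayley graph to have diameter `k`, with the lower bound on the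
diameter obtained from the number of vertices. -/
theorem isMixedAbelianCayley_of_covered {Γ : Type*} [AddCommGroup Γ] [Finite Γ] {S : Set Γ}
    {a b ι : Γ} (hS : S = {a, -a, b, ι}) (hι : ι + ι = 0) (hι0 : ι ≠ 0) (ha : a + a ≠ 0)
    (hb : b + b ≠ 0) (hba : b + a ≠ 0) (hba' : b ≠ a) (hbι : b + ι ≠ 0) {k N : ℕ}
    (hN : Nat.card Γ = N) (hkN : (2 * k) ^ 2 < 3 * N) (hc : CoveredWithin a b ι k) :
    IsMixedAbelianCayley S 1 1 1 k N := by
  have hgen := isMixedGeneratingSet_of_eq hS hι hι0 ha hb hba hba' hbι hc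
  refine ⟨inferInstance, hgen, le_antisymm
    ((diam_mixedCayley_le_iff hι hgen.zero_notMem hS k).2 hc) ?_, hN⟩
  rcases k with _ | k
  · simp
  · by_contra! hlt
    -- With `k + 1` for the diameter, the upper bound at `k` would contradict `hkN`.
    have hle : (mixedCayley S).diam ≤ (k : ℕ∞) := by
      rw [Nat.cast_add, Nat.cast_one] at hlt
      exact ENat.lt_add_one_iff (ENat.natCast_ne_top k) |>.1 hlt
    have := ((diam_mixedCayley_le_iff hι hgen.zero_notMem hS k).1 hle).three_mul_card_le hι hι0
    rw [hN] at this
    have h2 : 2 * (k + 1) = 2 * k + 2 := by ring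
    rw [h2] at hkN
    omega

/-! ### The extremal graphs -/

section Constructions

theorem zmod_natCast_ne_zero {N n : ℕ} (h0 : 0 < n) (h : n < N) : (n : ZMod N) ≠ 0 := by
  rw [Ne, ZMod.natCast_eq_zero_iff]
  exact fun hd => absurd (Nat.le_of_dvd h0 hd) (by omega)

/-- Covering a cyclic group: it suffices to write a multiple of the order plus any integer of a
period in terms of the generators. -/
theorem coveredWithin_zmod {N k : ℕ} [NeZero N] {b ι : ℤ}
    (h : ∀ c : ℤ, 0 ≤ c → c < N → ∃ (i : ℤ) (j e : ℕ) (t : ℤ), i.natAbs + j + e ≤ k ∧ e ≤ 1 ∧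
      c = i + j * b + e * ι + t * N) :
    CoveredWithin (1 : ZMod N) (b : ZMod N) (ι : ZMod N) k := by
  intro c
  obtain ⟨i, j, e, t, hle, he, hc⟩ := h c.val (by positivity) (by exact_mod_cast c.val_lt)
  refine ⟨i, j, e, hle, he, ?_⟩
  have := congrArg (Int.cast : ℤ → ZMod N) hc
  simpa using this

/-- The order `N` is `2 * x * (6 * x + 1) + 6 * x`: there are `2 * x` full rows and a last one
shorter by one. The start and end of row `J` are reached from the neighbouring multiples of `6 * x +
1`. Its middle is reached through `ι`, since `N / 2 = x * (6 * x + 1) + 3 * x` shifts by `x` rows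
and about half a row. -/
theorem exists_rep_three_mul {x : ℕ} (c : ℤ) (hc0 : 0 ≤ c)
    (hc : c < 12 * x ^ 2 + 8 * x) : ∃ (i : ℤ) (j e : ℕ) (t : ℤ),
      i.natAbs + j + e ≤ 3 * x ∧ e ≤ 1 ∧
      c = i + j * -(6 * x + 1 : ℤ) + e * (6 * x ^ 2 + 4 * x) + t * (12 * x ^ 2 + 8 * x) := by
  -- cover `-c` by intervals around the multiples of `6 * x + 1`
  obtain ⟨c', h0, hlt, s, hs⟩ : ∃ c' : ℤ, 0 ≤ c' ∧ c' < 12 * x ^ 2 + 8 * x ∧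
      ∃ s : ℤ, c = -c' + s * (12 * x ^ 2 + 8 * x) := by
    rcases hc0.eq_or_lt with rfl | h
    · exact ⟨0, le_rfl, hc, 0, by simp⟩
    · exact ⟨12 * x ^ 2 + 8 * x - c, by linarith, by linarith, 1, by ring⟩
  obtain ⟨J, r, hJ, hr, hcr⟩ : ∃ J r : ℕ, J ≤ 2 * x ∧ r < 6 * x + 1 ∧
      c' = J * (6 * x + 1) + r := by
    lift c' to ℕ using h0
    refine ⟨c' / (6 * x + 1), c' % (6 * x + 1), ?_, Nat.mod_lt _ (by omega), ?_⟩
    · have : c' < (2 * x + 1) * (6 * x + 1) := by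
        zify
        nlinarith
      have := (Nat.div_lt_iff_lt_mul (by omega)).2 this
      omega
    · have := Nat.div_add_mod' c' (6 * x + 1)
      exact_mod_cast this.symm
  rw [hs, hcr]
  rw [hcr] at hlt
  have hlast : J = 2 * x → r + 1 < 6 * x + 1 := by
    rintro rfl
    push_cast at hlt
    zify
    nlinarith
  by_cases h1 : r + J ≤ 3 * x
  · exact ⟨-r, J, 0, s, by omega, by omega, by push_cast; ring⟩
  by_cases h2 : 3 * x + 2 + J ≤ r ∧ J < 2 * x
  · exact ⟨6 * x + 1 - r, J + 1, 0, s, by omega, by omega, by push_cast; ring⟩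
  rcases lt_trichotomy J (2 * x) with h3 | h3 | h3
  · by_cases h4 : x ≤ J
    · obtain ⟨j, rfl⟩ := Nat.exists_eq_add_of_le h4
      exact ⟨3 * x - r, j, 1, s - 1, by omega, le_rfl, by push_cast; ring⟩
    · refine ⟨3 * x + 1 - r, J + x + 1, 1, s, by omega, le_rfl, by push_cast; ring⟩
  · subst h3
    by_cases h5 : 3 * x ≤ r
    · by_cases h6 : r + x + 1 ≤ 6 * x
      · exact ⟨3 * x - r, x, 1, s - 1, by omega, le_rfl, by push_cast; ring⟩
      · exact ⟨6 * x - r, 0, 0, s - 1, by omega, by omega, by push_cast; ring⟩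
    · exact ⟨3 * x - r, x, 1, s - 1, by omega, le_rfl, by push_cast; ring⟩
  · omega

/-- The same row argument, with `N = 2 * x * (6 * x + 5) + 6 * x + 4` and `N / 2 = x * (6 * x + 5) +
3 * x + 2`. -/
theorem exists_rep_three_mul_add_one {x : ℕ} (c : ℤ) (h0 : 0 ≤ c)
    (hc : c < 12 * x ^ 2 + 16 * x + 4) : ∃ (i : ℤ) (j e : ℕ) (t : ℤ),
      i.natAbs + j + e ≤ 3 * x + 1 ∧ e ≤ 1 ∧
      c = i + j * (6 * x + 5 : ℤ) + e * (6 * x ^ 2 + 8 * x + 2) +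
        t * (12 * x ^ 2 + 16 * x + 4) := by
  obtain ⟨J, r, hJ, hr, hcr⟩ : ∃ J r : ℕ, J ≤ 2 * x ∧ r < 6 * x + 5 ∧
      c = J * (6 * x + 5) + r := by
    lift c to ℕ using h0
    refine ⟨c / (6 * x + 5), c % (6 * x + 5), ?_, Nat.mod_lt _ (by omega), ?_⟩
    · have : c < (2 * x + 1) * (6 * x + 5) := by
        zify
        nlinarith
      have := (Nat.div_lt_iff_lt_mul (by omega)).2 this
      omega
    · have := Nat.div_add_mod' c (6 * x + 5)
      exact_mod_cast this.symm
  rw [hcr] at hc ⊢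
  have hlast : J = 2 * x → r < 6 * x + 4 := by
    rintro rfl
    push_cast at hc
    zify
    nlinarith
  by_cases h1 : r + J ≤ 3 * x + 1
  · exact ⟨r, J, 0, 0, by omega, by omega, by push_cast; ring⟩
  by_cases h2 : 3 * x + 5 + J ≤ r ∧ J < 2 * x
  · exact ⟨r - (6 * x + 5), J + 1, 0, 0, by omega, by omega, by push_cast; ring⟩
  rcases lt_trichotomy J (2 * x) with h3 | h3 | h3
  · by_cases h4 : x ≤ J
    · obtain ⟨j, rfl⟩ := Nat.exists_eq_add_of_le h4
      exact ⟨r - (3 * x + 2), j, 1, 0, by omega, le_rfl, by push_cast; ring⟩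
    · exact ⟨r - (3 * x + 3), J + x + 1, 1, -1, by omega, le_rfl, by push_cast; ring⟩
  · subst h3
    by_cases h5 : r ≤ 3 * x + 2
    · exact ⟨r - (3 * x + 2), x, 1, 0, by omega, le_rfl, by push_cast; ring⟩
    · exact ⟨r - (6 * x + 4), 0, 0, 1, by omega, by omega, by push_cast; ring⟩
  · omega

theorem exists_rep_prod {x : ℕ} (hx : 1 ≤ x) (c d : ℤ) (hc0 : 0 ≤ c)
    (hc : c < 6 * x) (hd0 : 0 ≤ d) (hd : d < 2 * x) : ∃ (i : ℤ) (j e : ℕ) (t u : ℤ),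
      i.natAbs + j + e ≤ 3 * x - 1 ∧ e ≤ 1 ∧
      c = i + e * (3 * x) + t * (6 * x) ∧ d = j + e * x + u * (2 * x) := by
  lift c to ℕ using hc0
  lift d to ℕ using hd0
  obtain ⟨i₀, t₀, hi₀, hi₀'⟩ : ∃ i₀ t₀ : ℤ, c = i₀ + t₀ * (6 * x) ∧ i₀.natAbs ≤ 3 * x := by
    by_cases h : c ≤ 3 * x
    · exact ⟨c, 0, by ring, by omega⟩
    · exact ⟨c - 6 * x, 1, by ring, by omega⟩
  -- Using the involution replaces `|i₀|` by `3 * x - |i₀|` and moves `d` by `x`. When the direct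
  -- representation is too long, `|i₁| ≤ d`, so this one fits.
  obtain ⟨i₁, t₁, hi₁, hi₁'⟩ : ∃ i₁ t₁ : ℤ, i₀ = i₁ + 3 * x + t₁ * (6 * x) ∧
      i₀.natAbs + i₁.natAbs = 3 * x := by
    by_cases h : 0 ≤ i₀
    · exact ⟨i₀ - 3 * x, 0, by ring, by omega⟩
    · exact ⟨i₀ + 3 * x, -1, by ring, by omega⟩
  by_cases h1 : i₀.natAbs + d ≤ 3 * x - 1
  · exact ⟨i₀, d, 0, t₀, 0, by omega, by omega, by rw [hi₀]; push_cast; ring, by simp⟩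
  by_cases h2 : x ≤ d
  · obtain ⟨j, rfl⟩ := Nat.exists_eq_add_of_le h2
    exact ⟨i₁, j, 1, t₀ + t₁, 0, by omega, le_rfl, by rw [hi₀, hi₁]; push_cast; ring,
      by push_cast; ring⟩
  · exact ⟨i₁, d + x, 1, t₀ + t₁, -1, by omega, le_rfl, by rw [hi₀, hi₁]; push_cast; ring,
      by push_cast; ring⟩

theorem isMixedAbelianCayley_circ_ten :
    IsMixedAbelianCayley ({1, -1, 2, 5} : Set (ZMod 10)) 1 1 1 2 10 := by
  refine isMixedAbelianCayley_of_covered (a := 1) (b := 2) (ι := 5) rfl (by decide) (by decide)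
    (by decide) (by decide) (by decide) (by decide) (by decide) (by simp) (by norm_num) ?_
  have h : ∀ c : ZMod 10, ∃ i ∈ ({0, 1, -1, 2, -2} : Finset ℤ), ∃ j ∈ Finset.range 3,
      ∃ e ∈ Finset.range 2,
        i.natAbs + j + e ≤ 2 ∧ c = i • (1 : ZMod 10) + j • (2 : ZMod 10) + e • (5 : ZMod 10) := by
    decide
  intro c
  obtain ⟨i, -, j, -, e, he, hle, hc⟩ := h c
  exact ⟨i, j, e, hle, by rw [Finset.mem_range] at he; omega, hc⟩

theorem isMixedAbelianCayley_prod {x : ℕ} (hx : 2 ≤ x) :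
    IsMixedAbelianCayley
      ({(1, 0), (-1, 0), (0, 1), (((3 * x : ℕ) : ZMod (6 * x)), (x : ZMod (2 * x)))} :
        Set (ZMod (6 * x) × ZMod (2 * x)))
      1 1 1 (3 * x - 1) (12 * x ^ 2) := by
  have : NeZero (6 * x) := ⟨by omega⟩
  have : NeZero (2 * x) := ⟨by omega⟩
  have hne : ∀ {n : ℕ} (u : ZMod (2 * x)), 0 < n → n < 6 * x →
      ((n : ZMod (6 * x)), u) ≠ 0 := by
    intro n u h1 h2 h
    exact zmod_natCast_ne_zero h1 h2 (congrArg Prod.fst h)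
  have hne' : ∀ {n : ℕ} (u : ZMod (6 * x)), 0 < n → n < 2 * x →
      (u, (n : ZMod (2 * x))) ≠ 0 := by
    intro n u h1 h2 h
    exact zmod_natCast_ne_zero h1 h2 (congrArg Prod.snd h)
  refine isMixedAbelianCayley_of_covered (a := (1, 0)) (b := (0, 1))
    (ι := (((3 * x : ℕ) : ZMod (6 * x)), (x : ZMod (2 * x)))) ?_ ?_ ?_ ?_ ?_ ?_ ?_ ?_ ?_ ?_ ?_
  · simp
  · ext
    · simp only [Prod.fst_add, Prod.fst_zero]
      rw [← Nat.cast_add, ZMod.natCast_eq_zero_iff]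
      exact ⟨1, by ring⟩
    · simp only [Prod.snd_add, Prod.snd_zero]
      rw [← Nat.cast_add, ZMod.natCast_eq_zero_iff]
      exact ⟨1, by ring⟩
  · exact hne _ (by omega) (by omega)
  · have := hne (n := 2) 0 (by omega) (by omega)
    convert this using 1
    ext <;> simp; norm_num
  · have := hne' (n := 2) 0 (by omega) (by omega)
    convert this using 1
    ext <;> simp; norm_num
  · have := hne (n := 1) 1 (by omega) (by omega)
    convert this using 1
    ext <;> simp
  · intro h
    have := zmod_natCast_ne_zero (n := 1) (N := 6 * x) (by omega) (by omega)
    apply this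
    simpa using (congrArg Prod.fst h).symm
  · have := hne (n := 3 * x) (1 + x) (by omega) (by omega)
    convert this using 1
    ext <;> simp
  · simp; ring
  · obtain ⟨y, rfl⟩ : ∃ y, x = y + 1 := ⟨x - 1, by omega⟩
    have : 3 * (y + 1) - 1 = 3 * y + 2 := by omega
    rw [this]
    nlinarith
  · rintro ⟨c, d⟩
    obtain ⟨i, j, e, t, u, hle, he, h1, h2⟩ := exists_rep_prod (x := x) (by omega)
      c.val d.val (by positivity) (by exact_mod_cast c.val_lt) (by positivity)
      (by exact_mod_cast d.val_lt)
    refine ⟨i, j, e, hle, he, ?_⟩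
    have h3 := congrArg (Int.cast : ℤ → ZMod (6 * x)) h1
    have h4 := congrArg (Int.cast : ℤ → ZMod (2 * x)) h2
    have h5 : (6 * x : ZMod (6 * x)) = 0 := by exact_mod_cast ZMod.natCast_self (6 * x)
    have h6 : (2 * x : ZMod (2 * x)) = 0 := by exact_mod_cast ZMod.natCast_self (2 * x)
    ext
    · simpa [h5] using h3
    · simpa [h6] using h4

theorem isMixedAbelianCayley_circ_three_mul {x : ℕ} (hx : 1 ≤ x) :
    IsMixedAbelianCayley
      ({1, -1, ((12 * x ^ 2 + 2 * x - 1 : ℕ) : ZMod (12 * x ^ 2 + 8 * x)),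
          ((6 * x ^ 2 + 4 * x : ℕ) : ZMod (12 * x ^ 2 + 8 * x))} :
        Set (ZMod (12 * x ^ 2 + 8 * x)))
      1 1 1 (3 * x) (12 * x ^ 2 + 8 * x) := by
  have hx2 : x ≤ x ^ 2 := Nat.le_self_pow (by norm_num) x
  have : NeZero (12 * x ^ 2 + 8 * x) := ⟨by omega⟩
  have hb : ((12 * x ^ 2 + 2 * x - 1 : ℕ) : ZMod (12 * x ^ 2 + 8 * x)) =
      ((-(6 * x + 1) : ℤ) : ZMod (12 * x ^ 2 + 8 * x)) := by
    have h1 : ((12 * x ^ 2 + 2 * x - 1 : ℕ) : ZMod (12 * x ^ 2 + 8 * x)) + (6 * x + 1 : ℕ) = 0 := by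
      rw [← Nat.cast_add, ZMod.natCast_eq_zero_iff]
      exact ⟨1, by omega⟩
    rw [eq_neg_of_add_eq_zero_left h1]
    push_cast; ring
  have hn : ((6 * x ^ 2 + 4 * x : ℕ) : ZMod (12 * x ^ 2 + 8 * x)) =
      ((6 * x ^ 2 + 4 * x : ℤ) : ZMod (12 * x ^ 2 + 8 * x)) := by push_cast; rfl
  have hne : ∀ {z : ZMod (12 * x ^ 2 + 8 * x)} (n : ℕ), z = n ∨ z = -n → 0 < n →
      n < 12 * x ^ 2 + 8 * x → z ≠ 0 := by
    intro z n hz h1 h2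
    have := zmod_natCast_ne_zero h1 h2
    rcases hz with rfl | rfl
    · exact this
    · exact neg_ne_zero.2 this
  refine isMixedAbelianCayley_of_covered rfl ?_ ?_ ?_ ?_ ?_ ?_ ?_ (Nat.card_zmod _) ?_ ?_
  · rw [← Nat.cast_add, ZMod.natCast_eq_zero_iff]
    exact ⟨1, by ring⟩
  · exact hne _ (Or.inl rfl) (by omega) (by omega)
  · exact hne 2 (Or.inl (by norm_num)) (by omega) (by omega)
  · exact hne (12 * x + 2) (Or.inr (by rw [hb]; push_cast; ring)) (by omega) (by nlinarith)
  · exact hne (6 * x) (Or.inr (by rw [hb]; push_cast; ring)) (by omega) (by omega)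
  · rw [← sub_ne_zero]
    exact hne (6 * x + 2) (Or.inr (by rw [hb]; push_cast; ring)) (by omega) (by omega)
  · have hodd : (6 * x ^ 2 + 4 * x) ≠ 6 * x + 1 := by
      intro h
      omega
    rcases lt_or_gt_of_ne hodd with h | h
    · obtain ⟨m, hm⟩ := Nat.exists_eq_add_of_lt h
      refine hne (m + 1) (Or.inr ?_) (by omega) (by omega)
      have := congrArg (Nat.cast : ℕ → ZMod (12 * x ^ 2 + 8 * x)) hm
      push_cast at this
      rw [hb]; push_cast
      linear_combination -this
    · obtain ⟨m, hm⟩ := Nat.exists_eq_add_of_lt h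
      refine hne (m + 1) (Or.inl ?_) (by omega) (by omega)
      have := congrArg (Nat.cast : ℕ → ZMod (12 * x ^ 2 + 8 * x)) hm
      push_cast at this
      rw [hb]; push_cast
      linear_combination this
  · nlinarith
  · rw [hb, hn]
    refine coveredWithin_zmod fun c h0 h1 => ?_
    push_cast at h1 ⊢
    exact exists_rep_three_mul c h0 h1

theorem isMixedAbelianCayley_circ_three_mul_add_one {x : ℕ} (hx : 1 ≤ x) :
    IsMixedAbelianCayley
      ({1, -1, ((6 * x + 5 : ℕ) : ZMod (12 * x ^ 2 + 16 * x + 4)),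
          ((6 * x ^ 2 + 8 * x + 2 : ℕ) : ZMod (12 * x ^ 2 + 16 * x + 4))} :
        Set (ZMod (12 * x ^ 2 + 16 * x + 4)))
      1 1 1 (3 * x + 1) (12 * x ^ 2 + 16 * x + 4) := by
  have hx2 : x ≤ x ^ 2 := Nat.le_self_pow (by norm_num) x
  have hne : ∀ {z : ZMod (12 * x ^ 2 + 16 * x + 4)} (n : ℕ), z = n → 0 < n →
      n < 12 * x ^ 2 + 16 * x + 4 → z ≠ 0 := by
    rintro z n rfl h1 h2
    exact zmod_natCast_ne_zero h1 h2
  refine isMixedAbelianCayley_of_covered rfl ?_ ?_ ?_ ?_ ?_ ?_ ?_ (Nat.card_zmod _) ?_ ?_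
  · rw [← Nat.cast_add, ZMod.natCast_eq_zero_iff]
    exact ⟨1, by ring⟩
  · exact hne _ rfl (by omega) (by omega)
  · exact hne 2 (by norm_num) (by omega) (by omega)
  · exact hne (12 * x + 10) (by push_cast; ring) (by omega) (by omega)
  · exact hne (6 * x + 6) (by push_cast; ring) (by omega) (by omega)
  · rw [← sub_ne_zero]
    exact hne (6 * x + 4) (by push_cast; ring) (by omega) (by omega)
  · rw [← Nat.cast_add, Ne, ZMod.natCast_eq_zero_iff]
    intro hd
    have h2 : 2 ∣ 12 * x ^ 2 + 16 * x + 4 := ⟨6 * x ^ 2 + 8 * x + 2, by ring⟩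
    have := h2.trans hd
    omega
  · nlinarith
  · have h := coveredWithin_zmod (N := 12 * x ^ 2 + 16 * x + 4) (k := 3 * x + 1)
      (b := 6 * x + 5) (ι := 6 * x ^ 2 + 8 * x + 2) (fun c h0 h1 => by
        push_cast at h1 ⊢
        exact exists_rep_three_mul_add_one c h0 h1)
    push_cast at h ⊢
    exact h

theorem isGreatest_orders {Γ : Type} [AddCommGroup Γ] {S : Set Γ} {k N : ℕ}
    (h : IsMixedAbelianCayley S 1 1 1 k N)
    (hub : ∀ n, 2 ∣ n → 3 * n ≤ (2 * k + 2) ^ 2 → (k = 2 → n ≠ 12) → n ≤ N) :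
    IsGreatest (mixedAbelianCayleyOrders 1 1 1 k) N := by
  refine ⟨⟨Γ, inferInstance, S, h⟩, fun n hn => ?_⟩
  obtain ⟨h1, h2, h3⟩ := card_bounds_of_mem_orders hn
  exact hub n h1 h2 h3

end Constructions

theorem mainTheorem3 :
    (IsGreatest (mixedAbelianCayleyOrders 1 1 1 2) 10 ∧
      IsMixedAbelianCayley ({1, -1, 2, 5} : Set (ZMod 10)) 1 1 1 2 10) ∧
    (∀ x : ℕ, 2 ≤ x →
      IsGreatest (mixedAbelianCayleyOrders 1 1 1 (3 * x - 1)) (12 * x ^ 2) ∧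
      IsMixedAbelianCayley
        ({(1, 0), (-1, 0), (0, 1), (((3 * x : ℕ) : ZMod (6 * x)), (x : ZMod (2 * x)))} :
          Set (ZMod (6 * x) × ZMod (2 * x)))
        1 1 1 (3 * x - 1) (12 * x ^ 2)) ∧
    (∀ x : ℕ, 1 ≤ x →
      IsGreatest (mixedAbelianCayleyOrders 1 1 1 (3 * x)) (12 * x ^ 2 + 8 * x) ∧
      IsMixedAbelianCayley
        ({1, -1, ((12 * x ^ 2 + 2 * x - 1 : ℕ) : ZMod (12 * x ^ 2 + 8 * x)),
            ((6 * x ^ 2 + 4 * x : ℕ) : ZMod (12 * x ^ 2 + 8 * x))} :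
          Set (ZMod (12 * x ^ 2 + 8 * x)))
        1 1 1 (3 * x) (12 * x ^ 2 + 8 * x)) ∧
    (∀ x : ℕ, 1 ≤ x →
      IsGreatest (mixedAbelianCayleyOrders 1 1 1 (3 * x + 1)) (12 * x ^ 2 + 16 * x + 4) ∧
      IsMixedAbelianCayley
        ({1, -1, ((6 * x + 5 : ℕ) : ZMod (12 * x ^ 2 + 16 * x + 4)),
            ((6 * x ^ 2 + 8 * x + 2 : ℕ) : ZMod (12 * x ^ 2 + 16 * x + 4))} :
          Set (ZMod (12 * x ^ 2 + 16 * x + 4)))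
        1 1 1 (3 * x + 1) (12 * x ^ 2 + 16 * x + 4)) := by
  refine ⟨⟨isGreatest_orders isMixedAbelianCayley_circ_ten ?_, isMixedAbelianCayley_circ_ten⟩,
    fun x hx => ⟨isGreatest_orders (isMixedAbelianCayley_prod hx) ?_,
      isMixedAbelianCayley_prod hx⟩,
    fun x hx => ⟨isGreatest_orders (isMixedAbelianCayley_circ_three_mul hx) ?_,
      isMixedAbelianCayley_circ_three_mul hx⟩,
    fun x hx => ⟨isGreatest_orders (isMixedAbelianCayley_circ_three_mul_add_one hx) ?_,
      isMixedAbelianCayley_circ_three_mul_add_one hx⟩⟩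
  · intro n h1 h2 h3
    have := h3 rfl
    omega
  · intro n _ h2 _
    have h3 : 2 * (3 * x - 1) + 2 = 6 * x := by omega
    -- The right side is three times the claimed order, so evenness is not needed here; in the next
    -- two cases it exceeds that by 4, which leaves only the odd value `N + 1` to exclude.
    rw [h3] at h2
    nlinarith
  · intro n h1 h2 _
    have h3 : (2 * (3 * x) + 2) ^ 2 = 36 * x ^ 2 + 24 * x + 4 := by ring
    omega
  · intro n h1 h2 _
    have h3 : (2 * (3 * x + 1) + 2) ^ 2 = 36 * x ^ 2 + 48 * x + 16 := by ring
    omega
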